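/- Let $K$ be an algebraically closed field of characteristic $2$, let $\lambda\in K$, and let $Q,B\in K[x_1,x_2,x_3]$ be homogeneous polynomials (possibly zero) of degrees $2$ and $4$ respectively. Let $X\subset\mathbb{P}^3_K$ be the quartic surface defined by $$F(x_1,x_2,x_3,z) := \lambda z^4 + z^2\,Q(x_1,x_2,x_3) + B(x_1,x_2,x_3) = 0,$$ and let $\mathrm{Sing}(X)\subset\mathbb{P}^3(K)$ be the set of points at which $F$ and all of its first partial derivatives vanish. If $X$ is normal, that is, if $\mathrm{Sing}(X)$ is a finite set, then $|\mathrm{Sing}(X)|\le 16$. -/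

import Mathlib

open MvPolynomial
open scoped LinearAlgebra.Projectivization

/-- The singular locus of the hypersurface `{F = 0}` of projective `3`-space over `K`, for a
homogeneous polynomial `F` in four variables: the points at which `F` and all its first
partial derivatives vanish. -/
def singularLocus {K : Type*} [Field K] (F : MvPolynomial (Fin 4) K) :
    Set (ℙ K (Fin 4 → K)) :=
  {p | eval p.rep F = 0 ∧ ∀ i : Fin 4, eval p.rep (pderiv i F) = 0}

/-- The surface `{F = 0}` in projective `3`-space is normal: as a hypersurface over an
algebraically closed field, this means that it has only finitely many singular points. -/
def IsNormalSurface {K : Type*} [Field K] (F : MvPolynomial (Fin 4) K) : Prop :=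
  (singularLocus F).Finite

/-- The quartic form `l z ^ 4 + z ^ 2 Q(x) + B(x)` in the variables `x = (x₀, x₁, x₂)` and
`z = x₃`, where `Q` and `B` are polynomials in `x` only. -/
noncomputable def evenQuartic {K : Type*} [Field K] (l : K) (Q B : MvPolynomial (Fin 3) K) :
    MvPolynomial (Fin 4) K :=
  C l * X 3 ^ 4 + X 3 ^ 2 * rename Fin.castSucc Q + rename Fin.castSucc B

theorem evenQuartic_isHomogeneous {K : Type*} [Field K] (l : K)
    {Q B : MvPolynomial (Fin 3) K} (hQ : Q.IsHomogeneous 2) (hB : B.IsHomogeneous 4) :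
    (evenQuartic l Q B).IsHomogeneous 4 := by
  refine IsHomogeneous.add (IsHomogeneous.add ?_ ?_) hB.rename_isHomogeneous
  · simpa using (isHomogeneous_C (Fin 4) l).mul ((isHomogeneous_X K (3 : Fin 4)).pow 4)
  · simpa using ((isHomogeneous_X K (3 : Fin 4)).pow 2).mul hQ.rename_isHomogeneous

theorem eval_smul_of_isHomogeneous {K : Type*} [Field K] {n : ℕ}
    {F : MvPolynomial (Fin 4) K} (hF : F.IsHomogeneous n) (t : K) (v : Fin 4 → K) :
    eval (t • v) F = t ^ n * eval v F := by
  rw [eval_eq, eval_eq, Finset.mul_sum]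
  refine Finset.sum_congr rfl fun d hd => ?_
  have h : ∑ i ∈ d.support, d i = n := by
    have := hF (mem_support_iff.mp hd)
    simpa [Finsupp.weight_apply, Finsupp.sum] using this
  simp only [Pi.smul_apply, smul_eq_mul, mul_pow, Finset.prod_mul_distrib,
    Finset.prod_pow_eq_pow_sum, h]
  ring

/-- For a homogeneous polynomial, membership in the singular locus can be tested on any
homogeneous coordinates of the point. -/
theorem mk_mem_singularLocus {K : Type*} [Field K] {n : ℕ}
    {F : MvPolynomial (Fin 4) K} (hF : F.IsHomogeneous n) (v : Fin 4 → K) (hv : v ≠ 0) :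
    Projectivization.mk K v hv ∈ singularLocus F ↔
      eval v F = 0 ∧ ∀ i : Fin 4, eval v (pderiv i F) = 0 := by
  obtain ⟨a, ha⟩ := Projectivization.exists_smul_eq_mk_rep K v hv
  have ha' : (a : K) • v = (Projectivization.mk K v hv).rep := ha
  simp only [singularLocus, Set.mem_ofPred_eq, ← ha', eval_smul_of_isHomogeneous hF,
    eval_smul_of_isHomogeneous hF.pderiv, mul_eq_zero, pow_eq_zero_iff', a.ne_zero,
    false_and, false_or]

/-! In characteristic two `∂F/∂z = 0`, so the singular points are given by `F = 0` and `z² ∂ᵢQ + ∂ᵢB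
= 0`, where `z` enters only through `z²`. Over `K` square roots exist and are unique, so eliminating
`z²` or `t²` loses no points and roots of one-variable polynomials count singular points.

The polar form of `Q` is alternating in three variables, hence degenerate. If it is nonzero, moving
a kernel vector to `(0 : 0 : 1)` leaves `e x y` with `e ≠ 0` as the only mixed term of `Q`. If it is
zero, either `B` has a critical point, which is moved there and gives `γ = 0`, or only `(0 : 0 : 0 :
1)` can be singular. The other coordinates are chosen so that `t³ y` is absent from `B`; then `∂F/∂t
= 0` reads `γ x t² + cubic x y = 0`.

If `γ ≠ 0`, then in the chart `x = 1` both `t²` and `z⁴` are polynomials in `y`, and `F²` becomes a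
polynomial of degree at most 14 in `y` (`isSing_one_iff_eliminant`). When `c₃ = 0` the degree is at
most 8, with at most 6 further points on `x = 0`. If `γ = 0`, the points with `(x, y) ≠ 0` lie over
the zeros of a binary cubic, at most 4 over each (`ncard_lineLocus_le`), and there are at most 2
points `(0 : 0 : 1 : z)`. The cubic cannot vanish identically, for then the singular locus would be
infinite (`false_of_cubicPoly_eq_zero`). The vertex `(0 : 0 : 0 : 1)` adds one more point. -/

/-! ### Counting points by roots of one-variable polynomials. -/

section RootCounting

variable {K α : Type*} [Field K]

theorem Set.ncard_le_natDegree_of_eval_eq_zero {S : Set α} {f : α → K} (hf : S.InjOn f)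
    {P : Polynomial K} (hP : P ≠ 0) (h : ∀ s ∈ S, P.eval (f s) = 0) : S.ncard ≤ P.natDegree := by
  classical
  calc S.ncard ≤ (P.roots.toFinset : Set K).ncard :=
        Set.ncard_le_ncard_of_injOn f (fun s hs => by simpa [hP] using h s hs) hf
    _ = P.roots.toFinset.card := Set.ncard_coe_finset _
    _ ≤ P.roots.card := Multiset.toFinset_card_le _
    _ ≤ P.natDegree := P.card_roots'

theorem Set.ncard_le_mul_natDegree {S : Set α} (hS : S.Finite) (f : α → K) (n : ℕ)
    {P : Polynomial K} (hP : P ≠ 0) (h : ∀ s ∈ S, P.eval (f s) = 0)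
    (hn : ∀ a, P.eval a = 0 → {s ∈ S | f s = a}.ncard ≤ n) : S.ncard ≤ n * P.natDegree := by
  classical
  have hroot : (f '' S).ncard ≤ P.natDegree :=
    Set.ncard_le_natDegree_of_eval_eq_zero (f := id) Function.injective_id.injOn hP
      (by rintro _ ⟨s, hs, rfl⟩; exact h s hs)
  rw [Set.ncard_eq_toFinset_card S hS]
  refine (Finset.card_le_mul_card_image (f := f) hS.toFinset n ?_).trans
    (Nat.mul_le_mul_left n ?_)
  · intro a ha
    obtain ⟨s, hs, rfl⟩ := Finset.mem_image.mp ha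
    refine le_trans (le_of_eq ?_) (hn (f s) (h s (hS.mem_toFinset.mp hs)))
    rw [← Set.ncard_coe_finset]
    congr 1
    ext x
    simp
  · rw [← Set.ncard_coe_finset]
    simpa using hroot

/-- Excludes the degenerate cases: an identically vanishing eliminant puts a singular point over
almost every parameter value. -/
theorem Set.Finite.false_of_forall_eval_ne_zero [Infinite K] {S : Set α} (hS : S.Finite)
    (f : α → K) {P : Polynomial K} (hP : P ≠ 0)
    (h : ∀ a, P.eval a ≠ 0 → ∃ s ∈ S, f s = a) : False := by
  have hfin : ({a | P.eval a = 0} : Set K).Finite := by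
    classical
    exact P.roots.toFinset.finite_toSet.subset fun a ha => by simpa [hP] using ha
  have hcompl : ({a | P.eval a = 0} : Set K)ᶜ.Finite :=
    (hS.image f).subset fun a ha => (h a ha).imp fun s hs => hs
  exact Set.infinite_univ (by simpa using hfin.union hcompl)

theorem Set.Finite.false_of_forall [Infinite K] {S : Set α} (hS : S.Finite)
    (f : α → K) (h : ∀ a, ∃ s ∈ S, f s = a) : False :=
  hS.false_of_forall_eval_ne_zero f one_ne_zero fun a _ => h a

end RootCounting

/-! ### Plane systems of equations in characteristic two. -/

section CharTwoFamilies

variable {K : Type*} [Field K] [IsAlgClosed K]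

theorem exists_quadratic_root {a b c : K} (h : a ≠ 0 ∨ b ≠ 0) :
    ∃ x, a * x ^ 2 + b * x + c = 0 := by
  by_cases ha : a = 0
  · have hb : b ≠ 0 := h.resolve_left (by simpa using ha)
    exact ⟨-c / b, by subst ha; field_simp; ring⟩
  · have hdeg : (Polynomial.C a * Polynomial.X ^ 2 + Polynomial.C b * Polynomial.X +
        Polynomial.C c).degree ≠ 0 := by
      rw [Polynomial.degree_quadratic ha]; decide
    obtain ⟨x, hx⟩ := IsAlgClosed.exists_root _ hdeg
    exact ⟨x, by simpa [Polynomial.IsRoot] using hx⟩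

theorem exists_sq_quadratic_root {a b c : K} (h : a ≠ 0 ∨ b ≠ 0) :
    ∃ z, a * z ^ 4 + b * z ^ 2 + c = 0 := by
  obtain ⟨x, hx⟩ := exists_quadratic_root (c := c) h
  obtain ⟨z, rfl⟩ := IsAlgClosed.exists_pow_nat_eq x zero_lt_two
  exact ⟨z, by linear_combination hx⟩

/-- A weighted conic in the coordinates `t²` and `z²`, with nonconstant leading form, is infinite. -/
theorem not_finite_of_conic_subset {S : Set (K × K)} {l c β u q d : K}
    (h : l ≠ 0 ∨ c ≠ 0 ∨ β ≠ 0)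
    (hS : ∀ t z, l * z ^ 4 + z ^ 2 * (u + c * t ^ 2) + β * t ^ 4 + q * t ^ 2 + d = 0 →
      (t, z) ∈ S) : ¬ S.Finite := by
  intro hfin
  -- If `l ≠ 0`, solve for `z` over every `t`; if `β ≠ 0`, solve for `t` over every `z`; if only `c
  -- ≠ 0`, solve for `z` away from the zeros of `u + c t²`.
  by_cases hl : l = 0
  · by_cases hβ : β = 0
    · have hc : c ≠ 0 := by tauto
      have hP : Polynomial.C u + Polynomial.C c * Polynomial.X ^ 2 ≠ (0 : Polynomial K) := by
        intro h
        have := congrArg (fun P => Polynomial.coeff P 2) h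
        simp at this
        exact hc this
      refine hfin.false_of_forall_eval_ne_zero Prod.fst hP fun t ht => ?_
      obtain ⟨z, hz⟩ := exists_sq_quadratic_root (a := (0 : K)) (b := u + c * t ^ 2)
        (c := β * t ^ 4 + q * t ^ 2 + d) (Or.inr (by simpa using ht))
      exact ⟨(t, z), hS t z (by subst hl; linear_combination hz), rfl⟩
    · refine hfin.false_of_forall Prod.snd fun z => ?_
      obtain ⟨t, ht⟩ := exists_sq_quadratic_root (a := β) (b := q + c * z ^ 2)
        (c := l * z ^ 4 + z ^ 2 * u + d) (Or.inl hβ)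
      exact ⟨(t, z), hS t z (by linear_combination ht), rfl⟩
  · refine hfin.false_of_forall Prod.fst fun t => ?_
    obtain ⟨z, hz⟩ := exists_sq_quadratic_root (a := l) (b := u + c * t ^ 2)
      (c := β * t ^ 4 + q * t ^ 2 + d) (Or.inl hl)
    exact ⟨(t, z), hS t z (by linear_combination hz), rfl⟩

variable [CharP K 2]

/-- Squaring is injective, so there are no more zeros than the quadratic in `z²` has. -/
theorem ncard_sq_quadratic_le {a b c : K} (hfin : {z : K | a * z ^ 4 + b * z ^ 2 + c = 0}.Finite) :
    {z : K | a * z ^ 4 + b * z ^ 2 + c = 0}.ncard ≤ 2 := by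
  set P : Polynomial K := Polynomial.C a * Polynomial.X ^ 2 + Polynomial.C b * Polynomial.X +
    Polynomial.C c with hPdef
  have hev (z : K) : P.eval (z ^ 2) = a * z ^ 4 + b * z ^ 2 + c := by simp [hPdef, ← pow_mul]
  by_cases hP : P = 0
  · exact (hfin.false_of_forall id fun z => ⟨z, by
      rw [Set.mem_ofPred_eq, ← hev, hP, Polynomial.eval_zero], rfl⟩).elim
  · exact (Set.ncard_le_natDegree_of_eval_eq_zero (f := fun z => z ^ 2)
      (CharTwo.sq_injective (R := K)).injOn hP fun z hz => (hev z).trans hz).trans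
      (by rw [hPdef]; compute_degree)

/-- A finite intersection of the weighted quadric `e z² + α t² + p t + r` with a weighted quartic
without odd powers of `t` has at most four points. -/
theorem ncard_lineLocus_le (e α p r l u c β q d : K)
    (hfin : {s : K × K | e * s.2 ^ 2 + α * s.1 ^ 2 + p * s.1 + r = 0 ∧
      l * s.2 ^ 4 + s.2 ^ 2 * (u + c * s.1 ^ 2) + β * s.1 ^ 4 + q * s.1 ^ 2 + d = 0}.Finite) :
    {s : K × K | e * s.2 ^ 2 + α * s.1 ^ 2 + p * s.1 + r = 0 ∧
      l * s.2 ^ 4 + s.2 ^ 2 * (u + c * s.1 ^ 2) + β * s.1 ^ 4 + q * s.1 ^ 2 + d = 0}.ncard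
      ≤ 4 := by
  set S := {s : K × K | e * s.2 ^ 2 + α * s.1 ^ 2 + p * s.1 + r = 0 ∧
      l * s.2 ^ 4 + s.2 ^ 2 * (u + c * s.1 ^ 2) + β * s.1 ^ 4 + q * s.1 ^ 2 + d = 0} with hS
  have h2 : (2 : K) = 0 := CharTwo.two_eq_zero
  by_cases he : e = 0
  · subst he
    set P : Polynomial K := Polynomial.C α * Polynomial.X ^ 2 + Polynomial.C p * Polynomial.X +
      Polynomial.C r with hPdef
    have hev (t : K) : P.eval t = α * t ^ 2 + p * t + r := by simp [hPdef]
    -- If `P = 0`, only the second equation remains, and its zero set is empty or infinite.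
    -- Otherwise there are at most two values of `t`, with at most two `z` over each.
    by_cases hP : P = 0
    · have hmem (t z : K) : (t, z) ∈ S ↔
          l * z ^ 4 + (u + c * t ^ 2) * z ^ 2 + (β * t ^ 4 + q * t ^ 2 + d) = 0 := by
        have := hev t
        rw [hP, Polynomial.eval_zero] at this
        simp only [hS, Set.mem_ofPred_eq]
        constructor
        · rintro ⟨-, h⟩; linear_combination h
        · intro h; exact ⟨by linear_combination -this, by linear_combination h⟩
      by_cases hne : l ≠ 0 ∨ c ≠ 0 ∨ β ≠ 0
      · exact (not_finite_of_conic_subset (u := u) (q := q) (d := d) hne (fun t z h =>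
          (hmem t z).mpr (by linear_combination h)) hfin).elim
      simp only [not_or, not_not] at hne
      obtain ⟨rfl, rfl, rfl⟩ := hne
      by_cases hu : u = 0
      · subst hu
        rcases S.eq_empty_or_nonempty with hemp | ⟨⟨t, z⟩, htz⟩
        · simp [hemp]
        · exact (hfin.false_of_forall Prod.snd fun z' => ⟨(t, z'), (hmem t z').mpr
            (by linear_combination (hmem t z).mp htz), rfl⟩).elim
      · exact (hfin.false_of_forall Prod.fst fun t =>
          (exists_sq_quadratic_root (Or.inr (by simpa using hu))).elim fun z hz =>
            ⟨(t, z), (hmem t z).mpr hz, rfl⟩).elim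
    · have hdeg : P.natDegree ≤ 2 := by rw [hPdef]; compute_degree
      refine (Set.ncard_le_mul_natDegree hfin Prod.fst 2 hP (fun s hs => ?_) fun t ht => ?_).trans
        (by omega)
      · rw [hev]; linear_combination hs.1
      · have himg : {s ∈ S | s.1 = t} = Prod.mk t '' {z | l * z ^ 4 + (u + c * t ^ 2) * z ^ 2 +
            (β * t ^ 4 + q * t ^ 2 + d) = 0} := by
          rw [hev] at ht
          ext ⟨t', z⟩
          simp only [hS, Set.mem_ofPred_eq, Set.mem_image, Prod.mk.injEq]
          constructor
          · rintro ⟨⟨-, h⟩, rfl⟩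
            exact ⟨z, by linear_combination h, rfl, rfl⟩
          · rintro ⟨z, h, rfl, rfl⟩
            exact ⟨⟨by linear_combination ht, by linear_combination h⟩, rfl⟩
        rw [himg, Set.ncard_image_of_injective _ (Prod.mk_right_injective t)]
        apply ncard_sq_quadratic_le
        refine Set.Finite.of_finite_image (f := Prod.mk t) ?_ (Prod.mk_right_injective t).injOn
        rw [← himg]
        exact hfin.subset fun s hs => hs.1
  -- Here `z² = W(t)` determines `z` from `t`, and substitution gives a polynomial of degree at most
  -- four in `t`.
  · set W : Polynomial K := Polynomial.C e⁻¹ * (Polynomial.C α * Polynomial.X ^ 2 +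
      Polynomial.C p * Polynomial.X + Polynomial.C r) with hW
    set P : Polynomial K := Polynomial.C l * W ^ 2 + W * (Polynomial.C u + Polynomial.C c *
      Polynomial.X ^ 2) + Polynomial.C β * Polynomial.X ^ 4 + Polynomial.C q * Polynomial.X ^ 2 +
      Polynomial.C d with hPdef
    have hWev (t : K) : W.eval t = e⁻¹ * (α * t ^ 2 + p * t + r) := by simp [hW]
    have hev (t : K) : P.eval t = l * W.eval t ^ 2 + W.eval t * (u + c * t ^ 2) + β * t ^ 4 +
      q * t ^ 2 + d := by simp [hPdef]
    have hiff (t z : K) : e * z ^ 2 + α * t ^ 2 + p * t + r = 0 ↔ z ^ 2 = W.eval t := by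
      rw [hWev, eq_inv_mul_iff_mul_eq₀ he]
      constructor
      · intro h; linear_combination h - (α * t ^ 2 + p * t + r) * h2
      · intro h; linear_combination h + (α * t ^ 2 + p * t + r) * h2
    by_cases hP : P = 0
    · refine (hfin.false_of_forall Prod.fst fun t => ?_).elim
      obtain ⟨z, hz⟩ := IsAlgClosed.exists_pow_nat_eq (W.eval t) zero_lt_two
      refine ⟨(t, z), ⟨(hiff t z).mpr hz, ?_⟩, rfl⟩
      have := hev t
      rw [hP, Polynomial.eval_zero, ← hz] at this
      linear_combination -this
    · refine (Set.ncard_le_natDegree_of_eval_eq_zero (f := Prod.fst) ?_ hP ?_).trans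
        (show P.natDegree ≤ 4 by rw [hPdef, hW]; compute_degree)
      · rintro ⟨t, z⟩ hz ⟨t', z'⟩ hz' (rfl : t = t')
        have := ((hiff _ _).mp hz.1).trans ((hiff _ _).mp hz'.1).symm
        exact Prod.ext rfl (CharTwo.sq_inj.mp this)
      · rintro ⟨t, z⟩ hz
        rw [hev, ← (hiff _ _).mp hz.1]
        linear_combination hz.2

end CharTwoFamilies

/-! ### The normal form and the count in each chart. -/

/-- Coefficients of the forms `Q = e x y + a x² + b y² + c t²` and
`B = β t⁴ + γ t³ x + t² (q₀ x² + q₁ x y + q₂ y²) + t (c₀ x³ + ⋯ + c₃ y³) + d₀ x⁴ + ⋯ + d₄ y⁴`,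
together with the coefficient `l` of `z⁴`. -/
structure EvenQuarticNormalForm (K : Type*) where
  (l e a b c β γ q₀ q₁ q₂ c₀ c₁ c₂ c₃ d₀ d₁ d₂ d₃ d₄ : K)

namespace EvenQuarticNormalForm

variable {K : Type*} [Field K] (D : EvenQuarticNormalForm K)

/-- The value of the quadratic form `Q`. -/
def quadric (x y t : K) : K := D.e * x * y + D.a * x ^ 2 + D.b * y ^ 2 + D.c * t ^ 2

/-- The coefficient of `t` in `B`. -/
def cubic (x y : K) : K :=
  D.c₀ * x ^ 3 + D.c₁ * x ^ 2 * y + D.c₂ * x * y ^ 2 + D.c₃ * y ^ 3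

/-- The value of the quartic form `B`. -/
def quartic (x y t : K) : K :=
  D.β * t ^ 4 + D.γ * t ^ 3 * x + t ^ 2 * (D.q₀ * x ^ 2 + D.q₁ * x * y + D.q₂ * y ^ 2) +
    t * D.cubic x y + D.d₀ * x ^ 4 + D.d₁ * x ^ 3 * y + D.d₂ * x ^ 2 * y ^ 2 +
    D.d₃ * x * y ^ 3 + D.d₄ * y ^ 4

/-- The equations, in characteristic two, of the affine cone over the singular locus of
`l z⁴ + z² Q + B`. -/
def IsSing (x y t z : K) : Prop :=
  D.l * z ^ 4 + z ^ 2 * D.quadric x y t + D.quartic x y t = 0 ∧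
  D.e * z ^ 2 * y + D.γ * t ^ 3 + D.q₁ * t ^ 2 * y + t * (D.c₀ * x ^ 2 + D.c₂ * y ^ 2) +
    D.d₁ * x ^ 2 * y + D.d₃ * y ^ 3 = 0 ∧
  D.e * z ^ 2 * x + D.q₁ * t ^ 2 * x + t * (D.c₁ * x ^ 2 + D.c₃ * y ^ 2) +
    D.d₁ * x ^ 3 + D.d₃ * x * y ^ 2 = 0 ∧
  D.γ * x * t ^ 2 + D.cubic x y = 0

/-- The singular points `(1 : y : t : z)`. -/
def chartX : Set (K × K × K) := {s | D.IsSing 1 s.1 s.2.1 s.2.2}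

/-- The singular points `(0 : 1 : t : z)`. -/
def chartY : Set (K × K) := {s | D.IsSing 0 1 s.1 s.2}

/-- The singular points `(0 : 0 : 1 : z)`. -/
def chartT : Set K := {z | D.IsSing 0 0 1 z}

/-- The polynomial `cubic 1 X`. -/
noncomputable def cubicPoly : Polynomial K :=
  Polynomial.C D.c₀ + Polynomial.C D.c₁ * Polynomial.X + Polynomial.C D.c₂ * Polynomial.X ^ 2 +
    Polynomial.C D.c₃ * Polynomial.X ^ 3

theorem eval_cubicPoly (m : K) : D.cubicPoly.eval m = D.cubic 1 m := by
  simp [cubicPoly, cubic]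

/-- `z⁴` as a function of `y` on the part of the locus `IsSing` in the chart `x = 1`, when `γ` and
`e` do not vanish. -/
noncomputable def heightPoly : Polynomial K :=
  Polynomial.C (D.e⁻¹ ^ 2) * (Polynomial.C (D.q₁ ^ 2) * (Polynomial.C D.γ⁻¹ * D.cubicPoly) ^ 2 +
    (Polynomial.C D.γ⁻¹ * D.cubicPoly) *
      (Polynomial.C D.c₁ + Polynomial.C D.c₃ * Polynomial.X ^ 2) ^ 2 +
    (Polynomial.C D.d₁ + Polynomial.C D.d₃ * Polynomial.X ^ 2) ^ 2)

/-- The square of `l z⁴ + z² Q + B` as a function of `y` in the chart `x = 1`, after elimination of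
`t` and `z`. -/
noncomputable def eliminant : Polynomial K :=
  Polynomial.C (D.l ^ 2) * D.heightPoly ^ 2 + D.heightPoly * (Polynomial.C D.e * Polynomial.X +
      Polynomial.C D.a + Polynomial.C D.b * Polynomial.X ^ 2) ^ 2 +
    D.heightPoly * Polynomial.C (D.c ^ 2) * (Polynomial.C D.γ⁻¹ * D.cubicPoly) ^ 2 +
    Polynomial.C (D.β ^ 2) * (Polynomial.C D.γ⁻¹ * D.cubicPoly) ^ 4 +
    Polynomial.C (D.γ ^ 2) * (Polynomial.C D.γ⁻¹ * D.cubicPoly) ^ 3 +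
    (Polynomial.C D.γ⁻¹ * D.cubicPoly) ^ 2 * (Polynomial.C D.q₀ +
      Polynomial.C D.q₁ * Polynomial.X + Polynomial.C D.q₂ * Polynomial.X ^ 2) ^ 2 +
    (Polynomial.C D.γ⁻¹ * D.cubicPoly) * D.cubicPoly ^ 2 +
    (Polynomial.C D.d₀ + Polynomial.C D.d₁ * Polynomial.X +
      Polynomial.C D.d₂ * Polynomial.X ^ 2 + Polynomial.C D.d₃ * Polynomial.X ^ 3 +
      Polynomial.C D.d₄ * Polynomial.X ^ 4) ^ 2

/-- `heightPoly` has degree at most 7, from the cubic times `(c₁ + c₃ X²)²`; its square gives 14. -/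
theorem natDegree_eliminant_le : D.eliminant.natDegree ≤ 14 := by
  unfold eliminant heightPoly cubicPoly
  compute_degree

/-- The bounds for `cubicPoly` and `heightPoly` drop to 2 and 4. -/
theorem natDegree_eliminant_le_of_eq_zero (h : D.c₃ = 0) : D.eliminant.natDegree ≤ 8 := by
  unfold eliminant heightPoly cubicPoly
  simp only [h, map_zero, zero_mul, add_zero]
  compute_degree

theorem natDegree_cubicPoly_le : D.cubicPoly.natDegree ≤ 3 := by
  unfold cubicPoly
  compute_degree

theorem natDegree_cubicPoly_le_of_eq_zero (h : D.c₃ = 0) : D.cubicPoly.natDegree ≤ 2 := by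
  unfold cubicPoly
  simp only [h, map_zero, zero_mul, add_zero]
  compute_degree

variable [CharP K 2]

variable {D} in
-- The `t`-derivative gives `t²`. The `y`-derivative and `F` still contain odd powers of `t`, so
-- both are squared: Frobenius is additive and injective, hence nothing is lost and only `t²` and
-- `z⁴` occur.
theorem isSing_one_iff_eliminant (hγ : D.γ ≠ 0) (he : D.e ≠ 0) (m t z : K) :
    D.IsSing 1 m t z ↔ t ^ 2 = D.γ⁻¹ * D.cubicPoly.eval m ∧ z ^ 4 = D.heightPoly.eval m ∧
      D.eliminant.eval m = 0 := by
  have h2 : (2 : K) = 0 := CharTwo.two_eq_zero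
  have hT : D.γ * 1 * t ^ 2 + D.cubic 1 m = 0 ↔ t ^ 2 = D.γ⁻¹ * D.cubicPoly.eval m := by
    rw [eq_inv_mul_iff_mul_eq₀ hγ, eval_cubicPoly]
    constructor
    · intro h; linear_combination h - D.cubic 1 m * h2
    · intro h; linear_combination h + D.cubic 1 m * h2
  have hW (ht : t ^ 2 = D.γ⁻¹ * D.cubicPoly.eval m) :
      D.e * z ^ 2 * 1 + D.q₁ * t ^ 2 * 1 + t * (D.c₁ * 1 ^ 2 + D.c₃ * m ^ 2) +
        D.d₁ * 1 ^ 3 + D.d₃ * 1 * m ^ 2 = 0 ↔ z ^ 4 = D.heightPoly.eval m := by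
    rw [← pow_eq_zero_iff two_ne_zero]
    simp only [heightPoly, Polynomial.eval_mul, Polynomial.eval_add, Polynomial.eval_pow,
      Polynomial.eval_C, Polynomial.eval_X, ← ht]
    rw [inv_pow, eq_inv_mul_iff_mul_eq₀ (pow_ne_zero 2 he)]
    simp only [CharTwo.add_sq, mul_pow]
    rw [← CharTwo.add_eq_zero (a := D.e ^ 2 * z ^ 4)]
    ring_nf
  have hE (ht : t ^ 2 = D.γ⁻¹ * D.cubicPoly.eval m) (hz : z ^ 4 = D.heightPoly.eval m) :
      D.l * z ^ 4 + z ^ 2 * D.quadric 1 m t + D.quartic 1 m t = 0 ↔ D.eliminant.eval m = 0 := by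
    rw [← pow_eq_zero_iff two_ne_zero]
    have hc := D.eval_cubicPoly m
    simp only [eliminant, Polynomial.eval_mul, Polynomial.eval_add, Polynomial.eval_pow,
      Polynomial.eval_C, Polynomial.eval_X, ← ht, ← hz, quadric, quartic]
    simp only [hc, CharTwo.add_sq, mul_pow]
    ring_nf
  constructor
  · rintro ⟨h0, -, h2, h3⟩
    have ht := hT.mp h3
    have hz := (hW ht).mp h2
    exact ⟨ht, hz, (hE ht hz).mp h0⟩
  · rintro ⟨ht, hz, h⟩
    have h2' := (hW ht).mpr hz
    have h3 := hT.mpr ht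
    refine ⟨(hE ht hz).mpr h, ?_, h2', h3⟩
    simp only [cubic] at h3
    -- Euler's relation `x ∂ₓ + y ∂ᵧ + t ∂ₜ = 0`, valid since the degrees 2 and 4 are even, makes
    -- the `x`-derivative redundant at `x = 1`.
    linear_combination m * h2' + t * h3 - t * (D.c₁ * m + D.c₃ * m ^ 3) * h2

/-- The `t`-derivative now involves `m` alone, Euler's relation removes the `x`-derivative, and `F`
loses its odd powers of `t`. -/
theorem isSing_one_iff_line (hγ : D.γ = 0) {m : K} (hm : D.cubic 1 m = 0) (t z : K) :
    D.IsSing 1 m t z ↔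
      D.e * z ^ 2 + D.q₁ * t ^ 2 + (D.c₁ + D.c₃ * m ^ 2) * t + (D.d₁ + D.d₃ * m ^ 2) = 0 ∧
      D.l * z ^ 4 + z ^ 2 * ((D.e * m + D.a + D.b * m ^ 2) + D.c * t ^ 2) + D.β * t ^ 4 +
        (D.q₀ + D.q₁ * m + D.q₂ * m ^ 2) * t ^ 2 +
        (D.d₀ + D.d₁ * m + D.d₂ * m ^ 2 + D.d₃ * m ^ 3 + D.d₄ * m ^ 4) = 0 := by
  have h2 : (2 : K) = 0 := CharTwo.two_eq_zero
  simp only [IsSing, quadric, quartic, hγ, hm]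
  simp only [cubic] at hm
  constructor
  · rintro ⟨h0, -, h2, -⟩
    exact ⟨by linear_combination h2, by linear_combination h0⟩
  · rintro ⟨h1, h0⟩
    exact ⟨by linear_combination h0,
      by linear_combination m * h1 + t * hm - t * (D.c₁ * m + D.c₃ * m ^ 3) * h2,
      by linear_combination h1, by ring⟩

omit [CharP K 2] in
theorem isSing_zero_one_iff (hc : D.c₃ = 0) (t z : K) :
    D.IsSing 0 1 t z ↔ D.e * z ^ 2 + D.γ * t ^ 3 + D.q₁ * t ^ 2 + D.c₂ * t + D.d₃ = 0 ∧
      D.l * z ^ 4 + z ^ 2 * (D.b + D.c * t ^ 2) + D.β * t ^ 4 + D.q₂ * t ^ 2 + D.d₄ = 0 := by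
  simp only [IsSing, quadric, quartic, cubic, hc]
  constructor
  · rintro ⟨h0, h1, -, -⟩
    exact ⟨by linear_combination h1, by linear_combination h0⟩
  · rintro ⟨h1, h0⟩
    exact ⟨by linear_combination h0, by linear_combination h1, by ring, by ring⟩

omit [CharP K 2] in
theorem chartY_eq_empty (hc : D.c₃ ≠ 0) : D.chartY = ∅ := by
  refine Set.eq_empty_of_forall_notMem fun s hs => hc ?_
  have := hs.2.2.2
  simp only [cubic] at this
  linear_combination this

omit [CharP K 2] in
theorem chartT_eq_empty (hγ : D.γ ≠ 0) : D.chartT = ∅ := by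
  refine Set.eq_empty_of_forall_notMem fun s hs => hγ ?_
  have := hs.2.1
  linear_combination this

variable [IsAlgClosed K]

theorem ncard_chartX_le_of_gamma_ne_zero (hγ : D.γ ≠ 0) (he : D.e ≠ 0) (hX : D.chartX.Finite) :
    D.chartX.ncard ≤ D.eliminant.natDegree := by
  by_cases hP : D.eliminant = 0
  · refine (hX.false_of_forall Prod.fst fun m => ?_).elim
    obtain ⟨t, ht⟩ := IsAlgClosed.exists_pow_nat_eq (D.γ⁻¹ * D.cubicPoly.eval m) zero_lt_two
    obtain ⟨z, hz⟩ := IsAlgClosed.exists_pow_nat_eq (D.heightPoly.eval m) zero_lt_four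
    exact ⟨(m, t, z), (isSing_one_iff_eliminant hγ he m t z).mpr ⟨ht, hz, by simp [hP]⟩, rfl⟩
  · refine Set.ncard_le_natDegree_of_eval_eq_zero (f := Prod.fst) ?_ hP
      fun s hs => ((isSing_one_iff_eliminant hγ he _ _ _).mp hs).2.2
    rintro ⟨m, t, z⟩ hs ⟨m', t', z'⟩ hs' (rfl : m = m')
    obtain ⟨ht, hz, -⟩ := (isSing_one_iff_eliminant hγ he _ _ _).mp hs
    obtain ⟨ht', hz', -⟩ := (isSing_one_iff_eliminant hγ he _ _ _).mp hs'
    have h1 := CharTwo.sq_inj.mp (ht.trans ht'.symm)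
    have h2 : (z ^ 2) ^ 2 = (z' ^ 2) ^ 2 := by
      rw [← pow_mul, ← pow_mul]; exact hz.trans hz'.symm
    have h3 := CharTwo.sq_inj.mp (CharTwo.sq_inj.mp h2)
    exact Prod.ext rfl (Prod.ext h1 h3)

/-- The `x`-derivative gives `z²` as a cubic in `t`; substituted in `F`, it leaves degree at most
six. -/
theorem ncard_chartY_le_six (hc : D.c₃ = 0) (he : D.e ≠ 0) (hY : D.chartY.Finite) :
    D.chartY.ncard ≤ 6 := by
  have h2 : (2 : K) = 0 := CharTwo.two_eq_zero
  set W : Polynomial K := Polynomial.C D.e⁻¹ * (Polynomial.C D.γ * Polynomial.X ^ 3 +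
    Polynomial.C D.q₁ * Polynomial.X ^ 2 + Polynomial.C D.c₂ * Polynomial.X +
    Polynomial.C D.d₃) with hW
  set P : Polynomial K := Polynomial.C D.l * W ^ 2 + W * (Polynomial.C D.b + Polynomial.C D.c *
    Polynomial.X ^ 2) + Polynomial.C D.β * Polynomial.X ^ 4 +
    Polynomial.C D.q₂ * Polynomial.X ^ 2 + Polynomial.C D.d₄ with hPdef
  have hWev (t : K) : W.eval t = D.e⁻¹ * (D.γ * t ^ 3 + D.q₁ * t ^ 2 + D.c₂ * t + D.d₃) := by
    simp [hW]
  have hev (t : K) : P.eval t = D.l * W.eval t ^ 2 + W.eval t * (D.b + D.c * t ^ 2) +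
      D.β * t ^ 4 + D.q₂ * t ^ 2 + D.d₄ := by simp [hPdef]
  have hiff (t z : K) : (t, z) ∈ D.chartY ↔ z ^ 2 = W.eval t ∧ P.eval t = 0 := by
    refine (D.isSing_zero_one_iff hc t z).trans ?_
    have h : D.e * z ^ 2 + D.γ * t ^ 3 + D.q₁ * t ^ 2 + D.c₂ * t + D.d₃ = 0 ↔
        z ^ 2 = W.eval t := by
      rw [hWev, eq_inv_mul_iff_mul_eq₀ he]
      constructor
      · intro h
        linear_combination h - (D.γ * t ^ 3 + D.q₁ * t ^ 2 + D.c₂ * t + D.d₃) * h2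
      · intro h
        linear_combination h + (D.γ * t ^ 3 + D.q₁ * t ^ 2 + D.c₂ * t + D.d₃) * h2
    rw [h, and_congr_right_iff]
    intro hz
    rw [hev, ← hz]
    ring_nf
  by_cases hP : P = 0
  · refine (hY.false_of_forall Prod.fst fun t => ?_).elim
    obtain ⟨z, hz⟩ := IsAlgClosed.exists_pow_nat_eq (W.eval t) zero_lt_two
    exact ⟨(t, z), (hiff t z).mpr ⟨hz, by simp [hP]⟩, rfl⟩
  · refine (Set.ncard_le_natDegree_of_eval_eq_zero (f := Prod.fst) ?_ hP
      fun s hs => ((hiff _ _).mp hs).2).trans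
      (show P.natDegree ≤ 6 by rw [hPdef, hW]; compute_degree)
    rintro ⟨t, z⟩ hz ⟨t', z'⟩ hz' (rfl : t = t')
    exact Prod.ext rfl (CharTwo.sq_inj.mp (((hiff _ _).mp hz).1.trans ((hiff _ _).mp hz').1.symm))

theorem ncard_chartY_le_four (hγ : D.γ = 0) (hc : D.c₃ = 0) (hY : D.chartY.Finite) :
    D.chartY.ncard ≤ 4 := by
  have h : D.chartY = {s : K × K | D.e * s.2 ^ 2 + D.q₁ * s.1 ^ 2 + D.c₂ * s.1 + D.d₃ = 0 ∧
      D.l * s.2 ^ 4 + s.2 ^ 2 * (D.b + D.c * s.1 ^ 2) + D.β * s.1 ^ 4 + D.q₂ * s.1 ^ 2 +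
        D.d₄ = 0} := by
    ext ⟨t, z⟩
    refine (D.isSing_zero_one_iff hc t z).trans ?_
    simp [hγ]
  rw [h] at hY ⊢
  exact ncard_lineLocus_le _ _ _ _ _ _ _ _ _ _ hY

theorem ncard_chartT_le_two (hγ : D.γ = 0) (hT : D.chartT.Finite) : D.chartT.ncard ≤ 2 := by
  have h : D.chartT = {z : K | D.l * z ^ 4 + D.c * z ^ 2 + D.β = 0} := by
    ext z
    simp [chartT, IsSing, quadric, quartic, cubic, hγ, mul_comm]
  rw [h] at hT ⊢
  exact ncard_sq_quadratic_le hT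

theorem ncard_chartX_le_of_gamma_eq_zero (hγ : D.γ = 0) (hP : D.cubicPoly ≠ 0)
    (hX : D.chartX.Finite) : D.chartX.ncard ≤ 4 * D.cubicPoly.natDegree := by
  have hmem {s : K × K × K} (hs : s ∈ D.chartX) : D.cubicPoly.eval s.1 = 0 := by
    rw [eval_cubicPoly]
    have := hs.2.2.2
    rw [hγ] at this
    linear_combination this
  refine Set.ncard_le_mul_natDegree hX Prod.fst 4 hP (fun s hs => hmem hs) fun m hm => ?_
  rw [eval_cubicPoly] at hm
  have h := D.isSing_one_iff_line hγ hm
  have himg : {s ∈ D.chartX | s.1 = m} = Prod.mk m '' {s : K × K |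
      D.e * s.2 ^ 2 + D.q₁ * s.1 ^ 2 + (D.c₁ + D.c₃ * m ^ 2) * s.1 + (D.d₁ + D.d₃ * m ^ 2) = 0 ∧
      D.l * s.2 ^ 4 + s.2 ^ 2 * ((D.e * m + D.a + D.b * m ^ 2) + D.c * s.1 ^ 2) +
        D.β * s.1 ^ 4 + (D.q₀ + D.q₁ * m + D.q₂ * m ^ 2) * s.1 ^ 2 +
        (D.d₀ + D.d₁ * m + D.d₂ * m ^ 2 + D.d₃ * m ^ 3 + D.d₄ * m ^ 4) = 0} := by
    ext ⟨m', t, z⟩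
    constructor
    · rintro ⟨hs, rfl⟩
      exact ⟨(t, z), (h t z).mp hs, rfl⟩
    · rintro ⟨s, hs, heq⟩
      cases heq
      exact ⟨(h _ _).mpr hs, rfl⟩
  rw [himg, Set.ncard_image_of_injective _ (Prod.mk_right_injective m)]
  apply ncard_lineLocus_le
  refine Set.Finite.of_finite_image (f := Prod.mk m) ?_ (Prod.mk_right_injective m).injOn
  rw [← himg]
  exact hX.subset fun s hs => hs.1

end EvenQuarticNormalForm

/-! ### Excluding an identically zero cubic, and the total over the charts. -/

namespace EvenQuarticNormalForm

variable {K : Type*} [Field K] [IsAlgClosed K]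

/-- A pencil of quadratic equations `A s² + P₁(m) s + P₂(m) = 0`, with `P₁` and `P₂`
binary forms of degrees two and four, is solvable for almost all `m` or vanishes identically for some `m`,
possibly `m = ∞`. -/
theorem exists_root_of_quadratic_pencil (A : K) (P₁ P₂ : Polynomial K) :
    (∃ P : Polynomial K, P ≠ 0 ∧ ∀ m, P.eval m ≠ 0 →
      ∃ s, A * s ^ 2 + P₁.eval m * s + P₂.eval m = 0) ∨
    (A = 0 ∧ ∃ m, P₁.eval m = 0 ∧ P₂.eval m = 0) ∨
    (A = 0 ∧ P₁.coeff 2 = 0 ∧ P₂.coeff 4 = 0) := by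
  by_cases hA : A = 0
  · by_cases hP₁ : P₁ = 0
    · by_cases hdeg : P₂.degree = 0
      · refine Or.inr (Or.inr ⟨hA, by simp [hP₁], ?_⟩)
        rw [Polynomial.eq_C_of_degree_eq_zero hdeg, Polynomial.coeff_C]
        simp
      · obtain ⟨m, hm⟩ := IsAlgClosed.exists_root P₂ hdeg
        exact Or.inr (Or.inl ⟨hA, m, by simp [hP₁], hm⟩)
    · exact Or.inl ⟨P₁, hP₁, fun m hm => exists_quadratic_root (Or.inr hm)⟩
  · exact Or.inl ⟨1, one_ne_zero, fun m _ => exists_quadratic_root (Or.inl hA)⟩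

theorem exists_sq_sq (τ w : K) : ∃ t z : K, t ^ 2 = τ ∧ z ^ 2 = w := by
  obtain ⟨t, ht⟩ := IsAlgClosed.exists_pow_nat_eq τ zero_lt_two
  obtain ⟨z, hz⟩ := IsAlgClosed.exists_pow_nat_eq w zero_lt_two
  exact ⟨t, z, ht, hz⟩

variable [CharP K 2] (D : EvenQuarticNormalForm K)

/-- For each `m`, the first equation of `isSing_one_iff_line` is a line in the coordinates `(t²,
z²)`. Parametrised by `s`, it turns `F` into a quadratic in `s`, whose coefficients form a pencil in
`m`. Such a pencil has solutions over almost all `m`, or a whole line of them over one `m`. -/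
theorem false_of_cubicPoly_eq_zero_of_ne_zero (hγ : D.γ = 0) (hP : D.cubicPoly = 0)
    (he : D.e ≠ 0 ∨ D.q₁ ≠ 0) (hX : D.chartX.Finite) (hY : D.chartY.Finite) : False := by
  have h2 : (2 : K) = 0 := CharTwo.two_eq_zero
  have hm (m : K) : D.cubic 1 m = 0 := by rw [← eval_cubicPoly, hP, Polynomial.eval_zero]
  have hc₁ : D.c₁ = 0 := by simpa [cubicPoly] using congrArg (Polynomial.coeff · 1) hP
  have hc₂ : D.c₂ = 0 := by simpa [cubicPoly] using congrArg (Polynomial.coeff · 2) hP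
  have hc₃ : D.c₃ = 0 := by simpa [cubicPoly] using congrArg (Polynomial.coeff · 3) hP
  obtain ⟨τ, w, hτw⟩ : ∃ τ w, D.e * w + D.q₁ * τ = 1 := by
    rcases he with he | he
    · exact ⟨0, D.e⁻¹, by simp [he]⟩
    · exact ⟨D.q₁⁻¹, 0, by simp [he]⟩
  set R : Polynomial K := Polynomial.C D.d₁ + Polynomial.C D.d₃ * Polynomial.X ^ 2 with hR
  set U : Polynomial K := Polynomial.C D.e * Polynomial.X + Polynomial.C D.a +
    Polynomial.C D.b * Polynomial.X ^ 2 with hU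
  set V : Polynomial K := Polynomial.C D.q₀ + Polynomial.C D.q₁ * Polynomial.X +
    Polynomial.C D.q₂ * Polynomial.X ^ 2 with hV
  set P₁ : Polynomial K := Polynomial.C D.q₁ * U + Polynomial.C (D.q₁ * D.c * τ + D.c * D.e * w) *
    R + Polynomial.C D.e * V with hP₁
  set P₂ : Polynomial K := Polynomial.C (D.l * w ^ 2 + D.c * w * τ + D.β * τ ^ 2) * R ^ 2 +
    Polynomial.C w * R * U + Polynomial.C τ * R * V +
    (Polynomial.C D.d₀ + Polynomial.C D.d₁ * Polynomial.X +
      Polynomial.C D.d₂ * Polynomial.X ^ 2 + Polynomial.C D.d₃ * Polynomial.X ^ 3 +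
      Polynomial.C D.d₄ * Polynomial.X ^ 4) with hP₂
  set A := D.l * D.q₁ ^ 2 + D.q₁ * D.c * D.e + D.β * D.e ^ 2 with hA
  have hmem (m s : K) (h : A * s ^ 2 + P₁.eval m * s + P₂.eval m = 0) :
      ∃ t z, (m, t, z) ∈ D.chartX ∧ w * t ^ 2 + τ * z ^ 2 = s := by
    set r := D.d₁ + D.d₃ * m ^ 2 with hr
    obtain ⟨t, z, ht, hz⟩ := exists_sq_sq (s * D.e + r * τ) (s * D.q₁ + r * w)
    -- The direction of the line is `(e, q₁)` and `r (τ, w)` is a point on it; `w t² + τ z²`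
    -- recovers `s`.
    refine ⟨t, z, (D.isSing_one_iff_line hγ (hm m) t z).mpr ⟨?_, ?_⟩, ?_⟩
    · rw [ht, hz, hc₁, hc₃]
      linear_combination r * hτw + (s * D.e * D.q₁ + r) * h2
    · have ht4 : t ^ 4 = (s * D.e + r * τ) ^ 2 := by rw [← ht]; ring
      have hz4 : z ^ 4 = (s * D.q₁ + r * w) ^ 2 := by rw [← hz]; ring
      rw [ht4, hz4, ht, hz]
      simp only [hP₁, hP₂, hU, hV, hR, Polynomial.eval_add, Polynomial.eval_mul,
        Polynomial.eval_pow, Polynomial.eval_C, Polynomial.eval_X, ← hr] at h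
      linear_combination h + (D.l * s * D.q₁ * r * w + D.β * s * D.e * r * τ) * h2
    · rw [ht, hz]
      linear_combination s * hτw + r * τ * w * h2
  rcases exists_root_of_quadratic_pencil A P₁ P₂ with ⟨P, hP0, h⟩ | ⟨hA0, m, h₁, h₂⟩ |
    ⟨hA0, h₁, h₂⟩
  · refine hX.false_of_forall_eval_ne_zero Prod.fst hP0 fun m hPm => ?_
    obtain ⟨s, hs⟩ := h m hPm
    obtain ⟨t, z, hmem, -⟩ := hmem m s hs
    exact ⟨_, hmem, rfl⟩
  · refine hX.false_of_forall (fun p => w * p.2.1 ^ 2 + τ * p.2.2 ^ 2) fun s => ?_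
    obtain ⟨t, z, hmem, hs⟩ := hmem m s (by rw [hA0, h₁, h₂]; ring)
    exact ⟨_, hmem, hs⟩
  -- The case `m = ∞`: the top coefficients of `P₁` and `P₂` are those of the same quadratic in the
  -- chart `x = 0`.
  · refine hY.false_of_forall (fun p => w * p.1 ^ 2 + τ * p.2 ^ 2) fun s => ?_
    obtain ⟨t, z, ht, hz⟩ := exists_sq_sq (s * D.e + D.d₃ * τ) (s * D.q₁ + D.d₃ * w)
    refine ⟨(t, z), (D.isSing_zero_one_iff hc₃ t z).mpr ⟨?_, ?_⟩, ?_⟩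
    · rw [ht, hz, hc₂, hγ]
      linear_combination D.d₃ * hτw + (s * D.e * D.q₁ + D.d₃) * h2
    · have hRd : R.natDegree ≤ 2 := by rw [hR]; compute_degree
      have hUd : U.natDegree ≤ 2 := by rw [hU]; compute_degree
      have hVd : V.natDegree ≤ 2 := by rw [hV]; compute_degree
      have hRc : R.coeff 2 = D.d₃ := by simp [hR]
      have hUc : U.coeff 2 = D.b := by simp [hU]
      have hVc : V.coeff 2 = D.q₂ := by simp [hV]
      have hRR : (R * R).coeff 4 = D.d₃ * D.d₃ :=
        (Polynomial.coeff_mul_add_eq_of_natDegree_le hRd hRd).trans (by rw [hRc])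
      have hRU : (R * U).coeff 4 = D.d₃ * D.b :=
        (Polynomial.coeff_mul_add_eq_of_natDegree_le hRd hUd).trans (by rw [hRc, hUc])
      have hRV : (R * V).coeff 4 = D.d₃ * D.q₂ :=
        (Polynomial.coeff_mul_add_eq_of_natDegree_le hRd hVd).trans (by rw [hRc, hVc])
      have hdc : (Polynomial.C D.d₀ + Polynomial.C D.d₁ * Polynomial.X +
          Polynomial.C D.d₂ * Polynomial.X ^ 2 + Polynomial.C D.d₃ * Polynomial.X ^ 3 +
          Polynomial.C D.d₄ * Polynomial.X ^ 4).coeff 4 = D.d₄ := by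
        simp
      have ht4 : t ^ 4 = (s * D.e + D.d₃ * τ) ^ 2 := by rw [← ht]; ring
      have hz4 : z ^ 4 = (s * D.q₁ + D.d₃ * w) ^ 2 := by rw [← hz]; ring
      rw [ht4, hz4, ht, hz]
      have h₁' : D.q₁ * D.b + (D.q₁ * D.c * τ + D.c * D.e * w) * D.d₃ + D.e * D.q₂ = 0 := by
        rw [← h₁]
        simp only [hP₁, Polynomial.coeff_add, Polynomial.coeff_C_mul, hRc, hUc, hVc]
      have h₂' : (D.l * w ^ 2 + D.c * w * τ + D.β * τ ^ 2) * D.d₃ ^ 2 + w * D.d₃ * D.b +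
          τ * D.d₃ * D.q₂ + D.d₄ = 0 := by
        rw [← h₂]
        rw [hP₂, Polynomial.coeff_add, hdc]
        simp only [Polynomial.coeff_add, pow_two R, mul_assoc, Polynomial.coeff_C_mul, hRR, hRU,
          hRV, pow_two]
      linear_combination s ^ 2 * hA0 + s * h₁' + h₂' +
        (D.l * s * D.q₁ * D.d₃ * w + D.β * s * D.e * D.d₃ * τ) * h2
    · show w * t ^ 2 + τ * z ^ 2 = s
      rw [ht, hz]
      linear_combination s * hτw + D.d₃ * τ * w * h2

/-- If `e = q₁ = 0`, the line equation becomes `d₁ + d₃ m² = 0`, solvable for some `m`, possibly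
`∞`. Over it lies an infinite conic, unless `l = c = β = 0`, when every `(0 : 0 : 1 : z)` is
singular. -/
theorem false_of_cubicPoly_eq_zero (hγ : D.γ = 0) (hP : D.cubicPoly = 0)
    (hX : D.chartX.Finite) (hY : D.chartY.Finite) (hT : D.chartT.Finite) : False := by
  by_cases he : D.e ≠ 0 ∨ D.q₁ ≠ 0
  · exact D.false_of_cubicPoly_eq_zero_of_ne_zero hγ hP he hX hY
  simp only [not_or, not_not] at he
  obtain ⟨he, hq₁⟩ := he
  have hm (m : K) : D.cubic 1 m = 0 := by rw [← eval_cubicPoly, hP, Polynomial.eval_zero]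
  have hc₁ : D.c₁ = 0 := by simpa [cubicPoly] using congrArg (Polynomial.coeff · 1) hP
  have hc₂ : D.c₂ = 0 := by simpa [cubicPoly] using congrArg (Polynomial.coeff · 2) hP
  have hc₃ : D.c₃ = 0 := by simpa [cubicPoly] using congrArg (Polynomial.coeff · 3) hP
  by_cases hne : D.l ≠ 0 ∨ D.c ≠ 0 ∨ D.β ≠ 0
  · by_cases hd₃ : D.d₃ = 0
    · refine not_finite_of_conic_subset (S := D.chartY) hne (u := D.b) (q := D.q₂) (d := D.d₄)
        (fun t z h => (D.isSing_zero_one_iff hc₃ t z).mpr ⟨?_, h⟩) hY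
      rw [he, hq₁, hγ, hc₂, hd₃]; ring
    · obtain ⟨m, hm'⟩ := exists_quadratic_root (a := D.d₃) (b := 0) (c := D.d₁) (Or.inl hd₃)
      refine not_finite_of_conic_subset (S := Prod.mk m ⁻¹' D.chartX) hne
        (fun t z h => (D.isSing_one_iff_line hγ (hm m) t z).mpr ⟨?_, h⟩)
        (hX.preimage (Prod.mk_right_injective m).injOn)
      rw [he, hq₁, hc₁, hc₃]; linear_combination hm'
  · simp only [not_or, not_not] at hne
    refine hT.false_of_forall id fun z => ⟨z, ?_, rfl⟩
    simp [chartT, IsSing, quadric, quartic, cubic, hγ, hne]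

/-- The number of singular points other than `(0 : 0 : 0 : 1)`. -/
theorem ncard_charts_le (h : D.e ≠ 0 ∨ D.γ = 0) (hX : D.chartX.Finite) (hY : D.chartY.Finite)
    (hT : D.chartT.Finite) : D.chartX.ncard + D.chartY.ncard + D.chartT.ncard ≤ 15 := by
  -- The bounds add up to 14 in every case: `12 + 0 + 2` or `8 + 4 + 2` if `γ = 0`, and `14` or `8 +
  -- 6` otherwise.
  by_cases hγ : D.γ = 0
  · have hP : D.cubicPoly ≠ 0 := fun hP => D.false_of_cubicPoly_eq_zero hγ hP hX hY hT
    have h1 := D.ncard_chartX_le_of_gamma_eq_zero hγ hP hX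
    have h3 := D.ncard_chartT_le_two hγ hT
    by_cases hc : D.c₃ = 0
    · have h2 := D.ncard_chartY_le_four hγ hc hY
      have := D.natDegree_cubicPoly_le_of_eq_zero hc
      omega
    · have h2 := D.natDegree_cubicPoly_le
      rw [D.chartY_eq_empty hc, Set.ncard_empty]
      omega
  · have he := h.resolve_right hγ
    have h1 := D.ncard_chartX_le_of_gamma_ne_zero hγ he hX
    rw [D.chartT_eq_empty hγ, Set.ncard_empty]
    by_cases hc : D.c₃ = 0
    · have h2 := D.ncard_chartY_le_six hc he hY
      have := D.natDegree_eliminant_le_of_eq_zero hc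
      omega
    · have h2 := D.natDegree_eliminant_le
      rw [D.chartY_eq_empty hc, Set.ncard_empty]
      omega

end EvenQuarticNormalForm

/-! ### From affine charts to projective space. -/

section Transport

variable {K : Type*} [Field K] [IsAlgClosed K] [CharP K 2]

/-- A finite set of points of projective three-space which in some linear coordinates is cut out
by the equations of a normal form has at most sixteen elements. -/
theorem EvenQuarticNormalForm.encard_le_sixteen (D : EvenQuarticNormalForm K)
    (hD : D.e ≠ 0 ∨ D.γ = 0) {S : Set (ℙ K (Fin 4 → K))} (hS : S.Finite)
    (Φ : (Fin 4 → K) ≃ₗ[K] (Fin 4 → K))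
    (hmem : ∀ (w : Fin 4 → K) (hw : Φ w ≠ 0),
      Projectivization.mk K (Φ w) hw ∈ S ↔ D.IsSing (w 0) (w 1) (w 2) (w 3)) :
    S.encard ≤ 16 := by
  have hne {w : Fin 4 → K} (i : Fin 4) (hw : w i ≠ 0) : Φ w ≠ 0 := fun h =>
    hw (by rw [(map_eq_zero_iff Φ Φ.injective).mp h]; rfl)
  have hinj {w w' : Fin 4 → K} (i : Fin 4) (hw : w i = 1) (hw' : w' i = 1) {h h'}
      (heq : Projectivization.mk K (Φ w) h = Projectivization.mk K (Φ w') h') : w = w' := by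
    obtain ⟨a, ha⟩ := (Projectivization.mk_eq_mk_iff' K _ _ h h').mp heq
    rw [← map_smul] at ha
    have ha' := Φ.injective ha
    have := congrFun ha' i
    rw [Pi.smul_apply, hw, hw', smul_eq_mul, mul_one] at this
    rw [← ha', this, one_smul]
  let fX : K × K × K → ℙ K (Fin 4 → K) := fun s =>
    Projectivization.mk K (Φ ![1, s.1, s.2.1, s.2.2]) (hne 0 one_ne_zero)
  let fY : K × K → ℙ K (Fin 4 → K) := fun s =>
    Projectivization.mk K (Φ ![0, 1, s.1, s.2]) (hne 1 one_ne_zero)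
  let fT : K → ℙ K (Fin 4 → K) := fun z =>
    Projectivization.mk K (Φ ![0, 0, 1, z]) (hne 2 one_ne_zero)
  let v : ℙ K (Fin 4 → K) := Projectivization.mk K (Φ ![0, 0, 0, 1]) (hne 3 one_ne_zero)
  have hfX : Function.Injective fX := fun s s' h => by
    have := hinj 0 rfl rfl h
    exact Prod.ext (congrFun this 1) (Prod.ext (congrFun this 2) (congrFun this 3))
  have hfY : Function.Injective fY := fun s s' h => by
    have := hinj 1 rfl rfl h
    exact Prod.ext (congrFun this 2) (congrFun this 3)
  have hfT : Function.Injective fT := fun s s' h => congrFun (hinj 2 rfl rfl h) 3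
  have hX : D.chartX.Finite := Set.Finite.of_finite_image (f := fX)
    (hS.subset (by rintro _ ⟨s, hs, rfl⟩; exact (hmem _ _).mpr hs)) hfX.injOn
  have hY : D.chartY.Finite := Set.Finite.of_finite_image (f := fY)
    (hS.subset (by rintro _ ⟨s, hs, rfl⟩; exact (hmem _ _).mpr hs)) hfY.injOn
  have hT : D.chartT.Finite := Set.Finite.of_finite_image (f := fT)
    (hS.subset (by rintro _ ⟨s, hs, rfl⟩; exact (hmem _ _).mpr hs)) hfT.injOn
  -- Allows the first nonzero coordinate to be normalised to one.
  have hscale (p : ℙ K (Fin 4 → K)) (hp : p ∈ S) : ∃ w : Fin 4 → K, w ≠ 0 ∧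
      ∀ a : K, a ≠ 0 → ∃ h, p = Projectivization.mk K (Φ (a • w)) h ∧
        D.IsSing (a * w 0) (a * w 1) (a * w 2) (a * w 3) := by
    refine ⟨Φ.symm p.rep, ?_, fun a ha => ?_⟩
    · exact (map_ne_zero_iff _ Φ.symm.injective).mpr p.rep_nonzero
    · have hne' : Φ (a • Φ.symm p.rep) ≠ 0 := by
        rw [map_smul, Φ.apply_symm_apply]
        exact smul_ne_zero ha p.rep_nonzero
      have hp' : p = Projectivization.mk K _ hne' := by
        conv_lhs => rw [← p.mk_rep]
        rw [Projectivization.mk_eq_mk_iff']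
        exact ⟨a⁻¹, by rw [map_smul, Φ.apply_symm_apply, inv_smul_smul₀ ha]⟩
      refine ⟨hne', hp', (hmem _ hne').mp (hp' ▸ hp)⟩
  have hcover : S ⊆ fX '' D.chartX ∪ fY '' D.chartY ∪ fT '' D.chartT ∪ {v} := by
    intro p hp
    obtain ⟨w, hw, h⟩ := hscale p hp
    by_cases h0 : w 0 = 0
    · by_cases h1 : w 1 = 0
      · by_cases h2 : w 2 = 0
        · have h3 : w 3 ≠ 0 := fun h3 => hw (by
            funext i; fin_cases i <;> assumption)
          obtain ⟨_, hp', -⟩ := h (w 3)⁻¹ (inv_ne_zero h3)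
          have hw' : (w 3)⁻¹ • w = ![0, 0, 0, 1] := by
            funext i; fin_cases i <;> simp [h0, h1, h2, h3]
          refine Or.inr (hp'.trans ?_)
          simp only [hw', v]
        · obtain ⟨_, hp', hs⟩ := h (w 2)⁻¹ (inv_ne_zero h2)
          have hw' : (w 2)⁻¹ • w = ![0, 0, 1, (w 2)⁻¹ * w 3] := by
            funext i; fin_cases i <;> simp [h0, h1, h2]
          rw [h0, h1, inv_mul_cancel₀ h2, mul_zero] at hs
          refine Or.inl (Or.inr ⟨_, hs, ?_⟩)
          rw [hp']
          simp only [hw', fT]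
      · obtain ⟨_, hp', hs⟩ := h (w 1)⁻¹ (inv_ne_zero h1)
        have hw' : (w 1)⁻¹ • w = ![0, 1, (w 1)⁻¹ * w 2, (w 1)⁻¹ * w 3] := by
          funext i; fin_cases i <;> simp [h0, h1]
        rw [h0, inv_mul_cancel₀ h1, mul_zero] at hs
        refine Or.inl (Or.inl (Or.inr ⟨(_, _), hs, ?_⟩))
        rw [hp']
        simp only [hw', fY]
    · obtain ⟨_, hp', hs⟩ := h (w 0)⁻¹ (inv_ne_zero h0)
      have hw' : (w 0)⁻¹ • w = ![1, (w 0)⁻¹ * w 1, (w 0)⁻¹ * w 2, (w 0)⁻¹ * w 3] := by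
        funext i; fin_cases i <;> simp [h0]
      rw [inv_mul_cancel₀ h0] at hs
      refine Or.inl (Or.inl (Or.inl ⟨(_, _, _), hs, ?_⟩))
      rw [hp']
      simp only [hw', fX]
  have hcount : S.ncard ≤ 16 := by
    have hfin := ((hX.image fX).union (hY.image fY)).union (hT.image fT)
    calc S.ncard ≤ _ := Set.ncard_le_ncard hcover (hfin.union (Set.finite_singleton v))
      _ ≤ _ := Set.ncard_union_le _ _
      _ ≤ (D.chartX.ncard + D.chartY.ncard + D.chartT.ncard) + 1 := by
        refine Nat.add_le_add ((Set.ncard_union_le _ _).trans (Nat.add_le_add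
          ((Set.ncard_union_le _ _).trans (Nat.add_le_add ?_ ?_)) ?_)) (Set.ncard_singleton v).le
        · exact Set.ncard_image_le hX
        · exact Set.ncard_image_le hY
        · exact Set.ncard_image_le hT
      _ ≤ 16 := Nat.succ_le_succ (D.ncard_charts_le hD hX hY hT)
  rw [← hS.cast_ncard_eq]
  exact_mod_cast hcount

end Transport

/-! ### Linear substitutions and ternary forms. -/

section Polynomials

variable {K : Type*} [Field K]

/-- The linear substitution `P(x) ↦ P(g x)`. -/
noncomputable def MvPolynomial.linearSubst {n : ℕ} (g : Matrix (Fin n) (Fin n) K)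
    (P : MvPolynomial (Fin n) K) : MvPolynomial (Fin n) K :=
  bind₁ (fun i => ∑ j, C (g i j) * X j) P

theorem MvPolynomial.IsHomogeneous.linearSubst {n d : ℕ} (g : Matrix (Fin n) (Fin n) K)
    {P : MvPolynomial (Fin n) K} (hP : P.IsHomogeneous d) :
    (P.linearSubst g).IsHomogeneous d := by
  simpa [MvPolynomial.linearSubst] using hP.aeval (fun i => ∑ j, C (g i j) * X j) (n := 1) fun i =>
    IsHomogeneous.sum _ _ _ fun j _ => isHomogeneous_C_mul_X _ _

theorem MvPolynomial.eval_linearSubst {n : ℕ} (g : Matrix (Fin n) (Fin n) K)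
    (P : MvPolynomial (Fin n) K) (x : Fin n → K) :
    eval x (P.linearSubst g) = eval (g.mulVec x) P := by
  induction P using MvPolynomial.induction_on with
  | C a => simp [linearSubst]
  | add p q hp hq => simpa [linearSubst] using congrArg₂ (· + ·) hp hq
  | mul_X p i hp =>
    simp only [linearSubst] at hp
    simp [linearSubst, hp, Matrix.mulVec, dotProduct]

theorem MvPolynomial.eval_pderiv_linearSubst {n : ℕ} (g : Matrix (Fin n) (Fin n) K)
    (P : MvPolynomial (Fin n) K) (x : Fin n → K) (j : Fin n) :
    eval x (pderiv j (P.linearSubst g)) = ∑ i, g i j * eval (g.mulVec x) (pderiv i P) := by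
  induction P using MvPolynomial.induction_on with
  | C a => simp [linearSubst]
  | add p q hp hq =>
    simp only [linearSubst] at hp hq
    simp [linearSubst, hp, hq, mul_add, Finset.sum_add_distrib]
  | mul_X p i hp =>
    have h := p.eval_linearSubst g x
    simp only [linearSubst] at hp h
    have hX : eval x (pderiv j (∑ k, C (g i k) * X k)) = g i j := by
      simp [pderiv_X, Pi.single_apply]
    have hXe : eval x (∑ k, C (g i k) * X k) = g.mulVec x i := by
      simp [Matrix.mulVec, dotProduct]
    simp only [linearSubst, map_mul, bind₁_X_right, pderiv_mul, map_add, hX, hXe, hp, h, eval_X, mul_add,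
      Finset.sum_add_distrib, Finset.sum_mul]
    congr 1
    · exact Finset.sum_congr rfl fun k _ => by ring
    · simp [pderiv_X, Pi.single_apply, mul_comm]

/-- A homogeneous ternary polynomial as a sum over exponent triples. -/
theorem MvPolynomial.IsHomogeneous.exists_eq_sum {n : ℕ} {P : MvPolynomial (Fin 3) K}
    (hP : P.IsHomogeneous n) : ∃ c : (Fin 3 → ℕ) → K,
      P = ∑ d ∈ Finset.Nat.antidiagonalTuple 3 n, C (c d) * (X 0 ^ d 0 * X 1 ^ d 1 * X 2 ^ d 2) := by
  refine ⟨fun d => coeff (Finsupp.equivFunOnFinite.symm d) P, ?_⟩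
  have hmon (d : Fin 3 → ℕ) (a : K) : C a * (X 0 ^ d 0 * X 1 ^ d 1 * X 2 ^ d 2) =
      monomial (Finsupp.equivFunOnFinite.symm d) a := by
    rw [monomial_eq, Finsupp.prod_fintype _ _ (by simp), Fin.prod_univ_three]
    simp
  simp only [hmon]
  ext m
  rw [coeff_sum]
  simp only [coeff_monomial]
  by_cases hm : m.degree = n
  · rw [Finset.sum_eq_single (⇑m)]
    · simp
    · intro d _ hd
      rw [if_neg]
      rintro rfl
      exact hd (by simp)
    · intro h
      exact (h (Finset.Nat.mem_antidiagonalTuple.mpr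
        (by rw [← hm, Finsupp.degree_eq_sum]))).elim
  · rw [hP.coeff_eq_zero hm, Finset.sum_eq_zero]
    intro d hd
    rw [if_neg]
    rintro rfl
    exact hm (by rw [← Finset.Nat.mem_antidiagonalTuple.mp hd, Finsupp.degree_eq_sum]; simp)

theorem MvPolynomial.IsHomogeneous.exists_ternary_quadric {Q : MvPolynomial (Fin 3) K}
    (hQ : Q.IsHomogeneous 2) : ∃ a b c e f g : K, Q = C e * X 0 * X 1 + C f * X 0 * X 2 +
      C g * X 1 * X 2 + C a * X 0 ^ 2 + C b * X 1 ^ 2 + C c * X 2 ^ 2 := by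
  obtain ⟨k, rfl⟩ := hQ.exists_eq_sum
  refine ⟨k ![2, 0, 0], k ![0, 2, 0], k ![0, 0, 2], k ![1, 1, 0], k ![1, 0, 1], k ![0, 1, 1], ?_⟩
  have : Finset.Nat.antidiagonalTuple 3 2 =
    {![2, 0, 0], ![0, 2, 0], ![0, 0, 2], ![1, 1, 0], ![1, 0, 1], ![0, 1, 1]} := by decide
  rw [this]
  repeat rw [Finset.sum_insert (by decide)]
  rw [Finset.sum_singleton]
  simp
  ring

theorem MvPolynomial.IsHomogeneous.exists_ternary_quartic {B : MvPolynomial (Fin 3) K}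
    (hB : B.IsHomogeneous 4) : ∃ β γ δ q₀ q₁ q₂ c₀ c₁ c₂ c₃ d₀ d₁ d₂ d₃ d₄ : K,
      B = C β * X 2 ^ 4 + C γ * X 2 ^ 3 * X 0 + C δ * X 2 ^ 3 * X 1 +
        X 2 ^ 2 * (C q₀ * X 0 ^ 2 + C q₁ * X 0 * X 1 + C q₂ * X 1 ^ 2) +
        X 2 * (C c₀ * X 0 ^ 3 + C c₁ * X 0 ^ 2 * X 1 + C c₂ * X 0 * X 1 ^ 2 + C c₃ * X 1 ^ 3) +
        (C d₀ * X 0 ^ 4 + C d₁ * X 0 ^ 3 * X 1 + C d₂ * X 0 ^ 2 * X 1 ^ 2 +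
          C d₃ * X 0 * X 1 ^ 3 + C d₄ * X 1 ^ 4) := by
  obtain ⟨k, rfl⟩ := hB.exists_eq_sum
  refine ⟨k ![0, 0, 4], k ![1, 0, 3], k ![0, 1, 3], k ![2, 0, 2], k ![1, 1, 2], k ![0, 2, 2],
    k ![3, 0, 1], k ![2, 1, 1], k ![1, 2, 1], k ![0, 3, 1], k ![4, 0, 0], k ![3, 1, 0],
    k ![2, 2, 0], k ![1, 3, 0], k ![0, 4, 0], ?_⟩
  have : Finset.Nat.antidiagonalTuple 3 4 =
    {![0, 0, 4], ![1, 0, 3], ![0, 1, 3], ![2, 0, 2], ![1, 1, 2], ![0, 2, 2],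
      ![3, 0, 1], ![2, 1, 1], ![1, 2, 1], ![0, 3, 1], ![4, 0, 0], ![3, 1, 0],
      ![2, 2, 0], ![1, 3, 0], ![0, 4, 0]} := by decide
  rw [this]
  repeat rw [Finset.sum_insert (by decide)]
  rw [Finset.sum_singleton]
  simp
  ring

/-- A nonzero vector is the last column of an invertible matrix whose middle column is annihilated
by a given covector. -/
theorem exists_isUnit_matrix_of_ne_zero {p : Fin 3 → K} (hp : p ≠ 0)
    (φ : Fin 3 → K) : ∃ g : Matrix (Fin 3) (Fin 3) K, IsUnit g ∧ (∀ i, g i 2 = p i) ∧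
      ∑ i, g i 1 * φ i = 0 := by
  let f : (Fin 3 → K) →ₗ[K] K := ∑ i, φ i • LinearMap.proj i
  have hf (x : Fin 3 → K) : f x = ∑ i, x i * φ i := by
    simp [f, mul_comm]
  have hker : 2 ≤ Module.finrank K (LinearMap.ker f) := by
    have h := f.finrank_range_add_finrank_ker
    have h' : Module.finrank K (LinearMap.range f) ≤ 1 := by
      simpa using Submodule.finrank_le (LinearMap.range f)
    simp at h
    omega
  -- The kernel has dimension at least two, so it is not contained in the line through `p`.
  obtain ⟨r, hr, hrp⟩ : ∃ r ∈ LinearMap.ker f, r ∉ Submodule.span K (Set.range ![p]) := by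
    by_contra! h
    have h1 := Submodule.finrank_mono (show LinearMap.ker f ≤ _ from h)
    have h2 := finrank_range_le_card (R := K) ![p]
    simp [Set.finrank] at h2 h1
    omega
  have hind : LinearIndependent K ![r, p] := by
    refine linearIndependent_finCons.mpr ⟨?_, hrp⟩
    simpa [linearIndependent_unique_iff] using hp
  obtain ⟨u, hu⟩ : ∃ u, u ∉ Submodule.span K (Set.range ![r, p]) := by
    by_contra! h
    have h2 := finrank_range_le_card (R := K) ![r, p]
    rw [Set.finrank, (Submodule.eq_top_iff'.mpr h)] at h2
    simp at h2
  have hind' : LinearIndependent K ![u, r, p] := linearIndependent_finCons.mpr ⟨hind, hu⟩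
  refine ⟨(Matrix.of ![u, r, p]).transpose, ?_, fun i => rfl, ?_⟩
  · rw [← Matrix.linearIndependent_cols_iff_isUnit]
    exact hind'
  · exact (hf r).symm.trans hr

end Polynomials

/-! ### Equations of the singular locus in characteristic two. -/

section SingularLocus

variable {K : Type*} [Field K] [CharP K 2]

/-- In characteristic two the singular locus of `l z⁴ + z² Q + B` is cut out by the form itself and
the derivatives `z² ∂Q + ∂B`. -/
theorem mk_mem_singularLocus_evenQuartic (l : K) {Q B : MvPolynomial (Fin 3) K}
    (hQ : Q.IsHomogeneous 2) (hB : B.IsHomogeneous 4) (v : Fin 4 → K) (hv : v ≠ 0) :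
    Projectivization.mk K v hv ∈ singularLocus (evenQuartic l Q B) ↔
      l * v 3 ^ 4 + v 3 ^ 2 * eval (Fin.init v) Q + eval (Fin.init v) B = 0 ∧
      ∀ i : Fin 3, v 3 ^ 2 * eval (Fin.init v) (pderiv i Q) +
        eval (Fin.init v) (pderiv i B) = 0 := by
  have h2 : (2 : K) = 0 := CharTwo.two_eq_zero
  have h4 : (4 : K) = 0 := by linear_combination 2 * h2
  have hev (P : MvPolynomial (Fin 3) K) :
      eval v (rename Fin.castSucc P) = eval (Fin.init v) P := by
    rw [eval_rename]; rfl
  have hlast (P : MvPolynomial (Fin 3) K) : pderiv 3 (rename Fin.castSucc P) = 0 := by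
    classical
    refine pderiv_eq_zero_of_notMem_vars fun h => ?_
    obtain ⟨i, -, hi⟩ := Finset.mem_image.mp (vars_rename Fin.castSucc P h)
    exact (Fin.castSucc_lt_last i).ne hi
  have hcast (i : Fin 3) : pderiv i.castSucc (X 3 : MvPolynomial (Fin 4) K) = 0 :=
    pderiv_X_of_ne (Fin.castSucc_lt_last i).ne'
  rw [mk_mem_singularLocus (evenQuartic_isHomogeneous l hQ hB), Fin.forall_fin_succ']
  have hz : eval v (pderiv (Fin.last 3) (evenQuartic l Q B)) = 0 := by
    change eval v (pderiv 3 (evenQuartic l Q B)) = 0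
    simp [evenQuartic, hlast, h2, h4]
  have hx (i : Fin 3) : eval v (pderiv i.castSucc (evenQuartic l Q B)) =
      v 3 ^ 2 * eval (Fin.init v) (pderiv i Q) + eval (Fin.init v) (pderiv i B) := by
    simp [evenQuartic, hcast, hev,
      pderiv_rename (Fin.castSucc_injective 3)]
  simp only [hz, hx, and_true]
  simp [evenQuartic, hev]

/-- Quadratic and quartic forms with prescribed vanishing at `(0 : 0 : 1)` have a normal form. -/
theorem exists_normalForm (l : K) {Q B : MvPolynomial (Fin 3) K}
    (hQ : Q.IsHomogeneous 2) (hB : B.IsHomogeneous 4)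
    (hQ₀ : eval ![0, 0, 1] (pderiv 0 Q) = 0) (hQ₁ : eval ![0, 0, 1] (pderiv 1 Q) = 0)
    (hB₁ : eval ![0, 0, 1] (pderiv 1 B) = 0) :
    ∃ D : EvenQuarticNormalForm K,
      (∀ x y t z, D.IsSing x y t z ↔
        l * z ^ 4 + z ^ 2 * eval ![x, y, t] Q + eval ![x, y, t] B = 0 ∧
        ∀ i : Fin 3, z ^ 2 * eval ![x, y, t] (pderiv i Q) + eval ![x, y, t] (pderiv i B) = 0) ∧
      (eval ![0, 0, 1] (pderiv 0 B) = 0 → D.γ = 0) ∧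
      (D.e = 0 → ∀ x y t i, eval ![x, y, t] (pderiv i Q) = 0) := by
  have h2 : (2 : K) = 0 := CharTwo.two_eq_zero
  have h3 : (3 : K) = 1 := by linear_combination h2
  have h4 : (4 : K) = 0 := by linear_combination 2 * h2
  obtain ⟨a, b, c, e, f, g, rfl⟩ := hQ.exists_ternary_quadric
  obtain ⟨β, γ, δ, q₀, q₁, q₂, c₀, c₁, c₂, c₃, d₀, d₁, d₂, d₃, d₄, rfl⟩ := hB.exists_ternary_quartic
  have hX (i j : Fin 3) : pderiv i (X j : MvPolynomial (Fin 3) K) = if j = i then 1 else 0 := by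
    rw [pderiv_X, Pi.single_apply]
  have hf : f = 0 := by simpa [hX] using hQ₀
  have hg : g = 0 := by simpa [hX] using hQ₁
  have hδ : δ = 0 := by simpa [hX] using hB₁
  subst hf hg hδ
  refine ⟨⟨l, e, a, b, c, β, γ, q₀, q₁, q₂, c₀, c₁, c₂, c₃, d₀, d₁, d₂, d₃, d₄⟩, ?_, ?_, ?_⟩
  · intro x y t z
    simp only [EvenQuarticNormalForm.IsSing, EvenQuarticNormalForm.quadric,
      EvenQuarticNormalForm.quartic, EvenQuarticNormalForm.cubic, Fin.forall_fin_succ,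
      IsEmpty.forall_iff, and_true]
    refine and_congr ?_ (and_congr ?_ (and_congr ?_ ?_))
    · simp
      ring_nf
    · simp [hX, h2, h3, h4]
      ring_nf
    · simp [hX, h2, h3, h4]
      ring_nf
    · simp [hX, h2, h3, h4]
      ring_nf
  · intro h
    simpa [hX] using h
  · rintro (rfl : e = 0) x y t i
    fin_cases i <;> simp [hX, h2]

end SingularLocus

/-! ### Linear changes of the plane coordinates. -/

section LinearChange

variable {K : Type*} [Field K]

/-- By the chain rule the gradient transforms by the transpose of `g`; hence its vanishing does not
depend on the coordinates. -/
theorem forall_sum_mul_eq_zero_iff {n : ℕ} {g : Matrix (Fin n) (Fin n) K} (hg : IsUnit g)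
    (u : Fin n → K) : (∀ j, ∑ i, g i j * u i = 0) ↔ ∀ i, u i = 0 := by
  refine ⟨fun h => ?_, fun h j => by simp [h]⟩
  have : Matrix.vecMul u g = Matrix.vecMul 0 g := by
    funext j
    simpa [Matrix.vecMul, dotProduct, mul_comm] using h j
  exact congrFun (Matrix.vecMul_injective_of_isUnit hg this)

/-- The automorphism acting by `g` on all coordinates but the last, which is fixed. -/
noncomputable def snocMulVecEquiv {n : ℕ} {g : Matrix (Fin n) (Fin n) K} (hg : IsUnit g) :
    (Fin (n + 1) → K) ≃ₗ[K] (Fin (n + 1) → K) :=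
  LinearEquiv.ofInjectiveEndo
    { toFun := fun w => Fin.snoc (g.mulVec (Fin.init w)) (w (Fin.last n))
      map_add' := fun v w => by
        have : Fin.init (v + w) = (Fin.init v + Fin.init w : Fin n → K) := rfl
        funext i
        refine Fin.lastCases ?_ (fun i => ?_) i <;> simp [this, Matrix.mulVec_add]
      map_smul' := fun a w => by
        have : Fin.init (a • w) = (a • Fin.init w : Fin n → K) := rfl
        funext i
        refine Fin.lastCases ?_ (fun i => ?_) i <;> simp [this, Matrix.mulVec_smul] }
    (by
      intro v w h
      have h' : (Fin.snoc (g.mulVec (Fin.init v)) (v (Fin.last n)) : Fin (n + 1) → K) =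
        Fin.snoc (g.mulVec (Fin.init w)) (w (Fin.last n)) := h
      obtain ⟨h1, h2⟩ := Fin.snoc_injective2 h'
      rw [← Fin.snoc_init_self v, ← Fin.snoc_init_self w,
        Matrix.mulVec_injective_of_isUnit hg h1, h2])

theorem snocMulVecEquiv_apply {n : ℕ} {g : Matrix (Fin n) (Fin n) K} (hg : IsUnit g)
    (w : Fin (n + 1) → K) :
    snocMulVecEquiv hg w = Fin.snoc (g.mulVec (Fin.init w)) (w (Fin.last n)) := rfl

end LinearChange

/-! ### Reduction to the normal form. -/

section Main

variable {K : Type*} [Field K] [CharP K 2]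

/-- The bound holds when some point `p` of the plane is critical for `Q`, and for `B` too unless the
polar form of `Q` is nonzero. -/
theorem encard_singularLocus_le_of_critical_point [IsAlgClosed K]
    (l : K) {Q B : MvPolynomial (Fin 3) K}
    (hQ : Q.IsHomogeneous 2) (hB : B.IsHomogeneous 4)
    (hX : IsNormalSurface (evenQuartic l Q B)) {p : Fin 3 → K} (hp : p ≠ 0)
    (hQp : ∀ i, eval p (pderiv i Q) = 0)
    (hBp : (∀ i, eval p (pderiv i B) = 0) ∨ ∃ x i, eval x (pderiv i Q) ≠ 0) :
    (singularLocus (evenQuartic l Q B)).encard ≤ 16 := by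
  -- Taking the covector to be the differential of `B` at `p` removes `t³ y` from the transformed
  -- quartic.
  obtain ⟨g, hg, hgp, hg1⟩ := exists_isUnit_matrix_of_ne_zero hp fun i => eval p (pderiv i B)
  have hgp' : g.mulVec ![0, 0, 1] = p := by
    funext i
    simp [Matrix.mulVec, dotProduct, Fin.sum_univ_three, hgp]
  obtain ⟨D, hD, hγ, he⟩ := exists_normalForm l (hQ.linearSubst g) (hB.linearSubst g)
    (by rw [eval_pderiv_linearSubst, hgp']; simp [hQp])
    (by rw [eval_pderiv_linearSubst, hgp']; simp [hQp])
    (by rw [eval_pderiv_linearSubst, hgp', hg1])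
  refine D.encard_le_sixteen ?_ hX (snocMulVecEquiv hg) fun w hw => ?_
  · rcases hBp with h | ⟨x, i, hx⟩
    · refine Or.inr (hγ ?_)
      rw [eval_pderiv_linearSubst, hgp']
      simp [h]
    · refine Or.inl fun he0 => hx ?_
      obtain ⟨y, rfl⟩ := Matrix.mulVec_surjective_iff_isUnit.mpr hg x
      refine (forall_sum_mul_eq_zero_iff hg fun i => eval (g.mulVec y) (pderiv i Q)).mp
        (fun j => ?_) i
      have hy : y = ![y 0, y 1, y 2] := by
        funext i; fin_cases i <;> rfl
      rw [← eval_pderiv_linearSubst, hy]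
      exact he he0 _ _ _ _
  · have hw' : ![w 0, w 1, w 2] = Fin.init w := by
      funext i; fin_cases i <;> rfl
    rw [mk_mem_singularLocus_evenQuartic l hQ hB, hD, hw', eval_linearSubst, eval_linearSubst]
    have hinit : Fin.init (snocMulVecEquiv hg w) = g.mulVec (Fin.init w) := by
      rw [snocMulVecEquiv_apply, Fin.init_snoc]
    have hlast : snocMulVecEquiv hg w 3 = w 3 := by
      rw [snocMulVecEquiv_apply]
      exact Fin.snoc_last (α := fun _ => K) _ _
    rw [hinit, hlast]
    refine and_congr Iff.rfl ?_
    rw [← forall_sum_mul_eq_zero_iff hg]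
    refine forall_congr' fun j => ?_
    rw [eval_pderiv_linearSubst, eval_pderiv_linearSubst, Finset.mul_sum,
      ← Finset.sum_add_distrib]
    refine Eq.congr (Finset.sum_congr rfl fun i _ => by ring) rfl

/-- In characteristic two a ternary quadratic form with nonzero polar form has a critical point. -/
theorem exists_ne_zero_eval_pderiv_eq_zero {Q : MvPolynomial (Fin 3) K} (hQ : Q.IsHomogeneous 2)
    (h : ∃ x i, eval x (pderiv i Q) ≠ 0) : ∃ p ≠ 0, ∀ i, eval p (pderiv i Q) = 0 := by
  have h2 : (2 : K) = 0 := CharTwo.two_eq_zero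
  obtain ⟨a, b, c, e, f, g, rfl⟩ := hQ.exists_ternary_quadric
  have hX (i j : Fin 3) : pderiv i (X j : MvPolynomial (Fin 3) K) = if j = i then 1 else 0 := by
    rw [pderiv_X, Pi.single_apply]
  -- The kernel of the alternating matrix with entries `e`, `f`, `g`.
  refine ⟨![g, f, e], fun h0 => ?_, fun i => ?_⟩
  · obtain ⟨x, i, hx⟩ := h
    have hg : g = 0 := congrFun h0 0
    have hf : f = 0 := congrFun h0 1
    have he : e = 0 := congrFun h0 2
    subst hg hf he
    apply hx
    fin_cases i <;> simp [hX, h2]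
  · fin_cases i <;> simp [hX, h2]
    · linear_combination e * f * h2
    · linear_combination e * g * h2
    · linear_combination f * g * h2

end Main

theorem mainTheorem3 {K : Type*} [Field K] [IsAlgClosed K] [CharP K 2]
    (l : K) (Q B : MvPolynomial (Fin 3) K)
    (hQ : Q.IsHomogeneous 2) (hB : B.IsHomogeneous 4)
    (hX : IsNormalSurface (evenQuartic l Q B)) :
    (singularLocus (evenQuartic l Q B)).encard ≤ 16 := by
  by_cases hq : ∃ x i, eval x (pderiv i Q) ≠ 0
  · obtain ⟨p, hp, hQp⟩ := exists_ne_zero_eval_pderiv_eq_zero hQ hq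
    exact encard_singularLocus_le_of_critical_point l hQ hB hX hp hQp (Or.inr hq)
  · push Not at hq
    by_cases hb : ∃ p ≠ 0, ∀ i, eval p (pderiv i B) = 0
    · obtain ⟨p, hp, hBp⟩ := hb
      exact encard_singularLocus_le_of_critical_point l hQ hB hX hp (hq p) (Or.inl hBp)
    · push Not at hb
      have hv : (![0, 0, 0, 1] : Fin 4 → K) ≠ 0 := fun h => one_ne_zero (congrFun h 3)
      -- With `∂Q = 0` everywhere, the plane part of a singular point is a critical point of `B`,
      -- hence zero.
      have hsub : singularLocus (evenQuartic l Q B) ⊆ {Projectivization.mk K _ hv} := by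
        intro p hp
        rw [← p.mk_rep, mk_mem_singularLocus_evenQuartic l hQ hB] at hp
        have hinit : Fin.init p.rep = (0 : Fin 3 → K) := by
          by_contra hne
          obtain ⟨i, hi⟩ := hb _ hne
          exact hi (by simpa [hq] using hp.2 i)
        rw [Set.mem_singleton_iff, ← p.mk_rep, Projectivization.mk_eq_mk_iff']
        refine ⟨p.rep 3, ?_⟩
        funext i
        refine Fin.lastCases ?_ (fun i => ?_) i
        · exact mul_one _
        · have : p.rep i.castSucc = 0 := congrFun hinit i
          rw [this]
          fin_cases i <;> exact mul_zero _
      refine (Set.encard_le_encard hsub).trans ?_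
      rw [Set.encard_singleton]
      norm_num
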